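/- Setting. Hilbert spaces are complex and separable, possibly of infinite dimension. A measurement over a Hilbert space $K$ is a countable family $(L_i)_{i\in I}$ of bounded operators on $K$ with $\sum_{i\in I} L_i^\dagger L_i=\mathrm{Id}$ in the weak operator topology. A density operator on $K$ is a nonzero positive operator of finite trace, not necessarily normalized; it represents the same state as its positive scalar multiples. If a measurement in the state $\sigma$ has outcome $i$, the new state is represented by $L_i\sigma L_i^\dagger$, and outcome $i$ has probability $\mathrm{Tr}(L_i\sigma L_i^\dagger)/\mathrm{Tr}(\sigma)$. A quantum circuit $\mathcal C$ has finitely many quantum wires carrying Hilbert spaces, finitely many gates, classical channels between gates, and a fixed execution schedule $(B_1,\dots,B_N)$ which partitions the gates into sets $B_n$ of gates fired simultaneously, such that gates in the same $B_n$ act on different wires and the gates with classical channels to a gate $G$ (the classical sources of $G$) are fired before $G$. Each gate $G$ is assigned a finite nonempty set of measurements over the tensor product of the wires it acts on, with disjoint outcome sets, and a selection function that picks, from the outcomes of the classical sources of $G$, the measurement to be executed; every measurement of $G$ is in the range of the selection function. (Unitary gates are measurements with one outcome.) At stage $n$ the tensor product of the measurements picked at the gates of $B_n$, tensored with the identity on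 the other wires, is performed. A computation path $\mu$ assigns to each gate $G$ an outcome $\mu(G)$ of the measurement which its selection function picks from the outcomes $\mu(F)$ at the classical sources $F$ of $G$. The probability $P_{\mathcal C}(\mu\mid\sigma)$ that the computation on initial state $\sigma$ follows $\mu$ is the product over the stages of the probabilities of the outcomes prescribed by $\mu$; if it is positive, the output $\mathrm{Out}_{\mathcal C}(\mu\mid\sigma)$ is the final state. The tensor product of all wires is identified with $\mathcal H\otimes\mathcal A$, where $\dim\mathcal H\ge 2$, and a unit vector $|a\rangle\in\mathcal A$ is fixed. The full input for a principal input $\rho$, a density operator on $\mathcal H$, is $\rho_a=\rho\otimes|a\rangle\langle a|$. For a unitary operator $U$ on $\mathcal H$, the circuit computes $U$ along $\mu$ if, for all density operators $\rho$ on $\mathcal H$ with $P_{\mathcal C}(\mu\mid\rho_a)>0$, the operators $\mathrm{Tr}_{\mathcal A}\big(\mathrm{Out}_{\mathcal C}(\mu\mid\rho_a)\big)$ and $U\rho U^\dagger$ represent the same state. Corollary. Let $\mathcal G$ be a set of computation paths through $\mathcal C$. Suppose that for every $\mu\in\mathcal G$ there is a unitary operator $U_\mu$ on $\mathcal H$ such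 that $\mathcal C$ computes $U_\mu$ along $\mu$. Then the probability $\sum_{\mu\in\mathcal G}P_{\mathcal C}(\mu\mid\rho_a)$ that the computation of $\mathcal C$ on principal input $\rho$ follows a path in $\mathcal G$ is the same for all density operators $\rho$ on $\mathcal H$. -/

import Mathlib

open scoped ENNReal TensorProduct lp

noncomputable section

namespace QCircuit

universe u v

/-! ### Traces, density operators, tensor products of two Hilbert spaces -/

section States

variable (K : Type*) [NormedAddCommGroup K] [InnerProductSpace ℂ K] [CompleteSpace K]

/-- The index set of a fixed orthonormal (Hilbert) basis of `K`. -/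
def BasisIndex : Set K := (exists_hilbertBasis ℂ K).choose

/-- A fixed orthonormal (Hilbert) basis of `K`. -/
def basis : HilbertBasis (BasisIndex K) ℂ K := (exists_hilbertBasis ℂ K).choose_spec.choose

variable {K}

/-- The trace, in `[0, ∞]`, of a positive operator: the sum of its diagonal entries in an
orthonormal basis (for positive operators the basis is immaterial). -/
def trace (T : K →L[ℂ] K) : ℝ≥0∞ :=
  ∑' i, ENNReal.ofReal (RCLike.re (inner ℂ (basis K i) (T (basis K i))))

/-- Density operators, not necessarily normalized: nonzero positive operators of finite trace. -/
structure IsDensityOperator (ρ : K →L[ℂ] K) : Prop where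
  ne_zero : ρ ≠ 0
  isPositive : ρ.IsPositive
  trace_ne_top : trace ρ ≠ ⊤

/-- Two (not necessarily normalized) density operators represent the same state if they differ by
a positive scalar factor only. -/
def SameState (ρ σ : K →L[ℂ] K) : Prop := ∃ c : ℝ, 0 < c ∧ ρ = (c : ℂ) • σ

/-- A measurement with outcome set `I`: operators `L i` with `∑ i, (L i)† (L i) = 1`, the sum
converging in the weak operator topology. -/
structure Measurement (I : Type*) (K : Type*) [NormedAddCommGroup K] [InnerProductSpace ℂ K]
    [CompleteSpace K] where
  /-- The operator of an outcome. -/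
  op : I → K →L[ℂ] K
  complete : HasSum
    (fun i => ContinuousLinearMapWOT.ofCLM (ContinuousLinearMap.adjoint (op i) ∘L op i))
    (ContinuousLinearMapWOT.ofCLM (ContinuousLinearMap.id ℂ K))

end States

section Tensor

variable (H A : Type*) [NormedAddCommGroup H] [InnerProductSpace ℂ H] [CompleteSpace H]
  [NormedAddCommGroup A] [InnerProductSpace ℂ A]

/-- The Hilbert space tensor product of `H` and `A`: the completion of the algebraic one. -/
abbrev HTensor : Type _ := UniformSpace.Completion (H ⊗[ℂ] A)

variable {A}

/-- The operator `x ↦ x ⊗ v` from `H` to `H ⊗ A`. -/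
def tensorRight (v : A) : H →L[ℂ] HTensor H A :=
  (UniformSpace.Completion.toComplL : H ⊗[ℂ] A →L[ℂ] HTensor H A) ∘L
    ((TensorProduct.mkL ℂ H A).flip v)

variable {H}

/-- The full input `ρ ⊗ |a⟩⟨a|` on `H ⊗ A`, as the composition of `x ⊗ v ↦ ⟨a, v⟩ x`, of `ρ`, and of
`x ↦ x ⊗ a`. -/
def fullInput (a : A) (ρ : H →L[ℂ] H) : HTensor H A →L[ℂ] HTensor H A :=
  tensorRight H a ∘L ρ ∘L ContinuousLinearMap.adjoint (tensorRight H a)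

/-- The partial trace over `A` of a positive trace-class operator `σ` on `H ⊗ A`: the operator with
`⟨x, Tr_A(σ) y⟩ = ∑ j, ⟨x ⊗ e j, σ (y ⊗ e j)⟩` for an orthonormal basis `e` of `A`. For such `σ` the
series of operators converges in norm, because the norm of each term is at most its trace, and
these traces add up to that of `σ`. -/
def partialTrace [CompleteSpace A] (σ : HTensor H A →L[ℂ] HTensor H A) : H →L[ℂ] H :=
  ∑' j, ContinuousLinearMap.adjoint (tensorRight H (basis A j)) ∘L σ ∘L
    tensorRight H (basis A j)

theorem fullInput_tmul (a v : A) (ρ : H →L[ℂ] H) (x : H) :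
    fullInput a ρ ((x ⊗ₜ[ℂ] v : H ⊗[ℂ] A) : HTensor H A) =
      inner ℂ a v • ((ρ x ⊗ₜ[ℂ] a : H ⊗[ℂ] A) : HTensor H A) := by
  have h : ContinuousLinearMap.adjoint (tensorRight H a)
      ((x ⊗ₜ[ℂ] v : H ⊗[ℂ] A) : HTensor H A) = inner ℂ a v • x := by
    refine ext_inner_left ℂ fun y => ?_
    rw [ContinuousLinearMap.adjoint_inner_right, inner_smul_right]
    change inner ℂ ((y ⊗ₜ[ℂ] a : H ⊗[ℂ] A) : HTensor H A) _ = _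
    rw [UniformSpace.Completion.inner_coe, TensorProduct.inner_tmul, mul_comm]
  change tensorRight H a (ρ (ContinuousLinearMap.adjoint (tensorRight H a) _)) = _
  rw [h, map_smul, map_smul]
  rfl

end Tensor

/-! ### Tensor products of finitely many Hilbert spaces, and operators acting on some factors -/

section PiSums

/-- Absolutely convergent sums in finitely many variables multiply (auxiliary to `inner_tprod`). -/
def PiP (W : Type u) [Fintype W] : Prop := ∀ {ι : W → Type v} (f : (w : W) → ι w → ℂ),
    (∀ w, Summable fun i => ‖f w i‖) →
    Summable (fun t : (w : W) → ι w => ‖∏ w, f w (t w)‖) ∧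
    ∑' t : (w : W) → ι w, ∏ w, f w (t w) = ∏ w, ∑' i, f w i

theorem piP_equiv (α β : Type u) [Fintype β] (e : α ≃ β) (ih : @PiP.{u,v} α (Fintype.ofEquiv β e.symm)) :
    PiP.{u,v} β := by
  intro ι f hf
  let _ := Fintype.ofEquiv β e.symm
  obtain ⟨h1, h2⟩ := ih (fun a => f (e a)) (fun a => hf (e a))
  have key : ∀ t : (b : β) → ι b,
      ∏ a, f (e a) ((Equiv.piCongrLeft ι e).symm t a) = ∏ b, f b (t b) := fun t => by
    rw [← e.prod_comp]
    rfl
  constructor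
  · rw [← (Equiv.piCongrLeft ι e).symm.summable_iff] at h1
    refine h1.congr fun t => ?_
    simp only [Function.comp]
    rw [key]
  · rw [← (Equiv.piCongrLeft ι e).symm.tsum_eq] at h2
    simp_rw [key] at h2
    rw [h2, ← e.prod_comp]

theorem piP_option (α : Type u) [Fintype α] (ih : PiP.{u,v} α) : PiP.{u,v} (Option α) := by
  intro ι f hf
  obtain ⟨h1, h2⟩ := ih (fun a => f (some a)) (fun a => hf (some a))
  have key : ∀ p : ι none × ((a : α) → ι (some a)),
      ∏ w, f w ((Equiv.piOptionEquivProd (β := ι)).symm p w) =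
        f none p.1 * ∏ a, f (some a) (p.2 a) := fun p => by
    rw [Fintype.prod_option]; rfl
  constructor
  · rw [← (Equiv.piOptionEquivProd (β := ι)).symm.summable_iff]
    refine (summable_mul_of_summable_norm (f := fun i => ‖f none i‖)
      (g := fun t : (a : α) → ι (some a) => ‖∏ a, f (some a) (t a)‖)
      (by simpa using hf none) (by simpa using h1)).congr fun p => ?_
    simp only [Function.comp]
    rw [key, norm_mul]
  · rw [← (Equiv.piOptionEquivProd (β := ι)).symm.tsum_eq]
    simp_rw [key]
    rw [Fintype.prod_option, ← h2]
    exact (tsum_mul_tsum_of_summable_norm (hf none) h1).symm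

theorem piP_all (W : Type u) [Fintype W] : PiP.{u,v} W :=
  Fintype.induction_empty_option (P := fun W _ => PiP.{u,v} W) (fun α β _ e ih => piP_equiv α β e ih)
    (by
      intro ι f _
      exact ⟨Summable.of_finite, by simp [tsum_fintype]⟩)
    (fun α _ ih => piP_option α ih) W

end PiSums

section Family

variable {W : Type u} (Q : W → Type v) [∀ w, NormedAddCommGroup (Q w)]
  [∀ w, InnerProductSpace ℂ (Q w)] [∀ w, CompleteSpace (Q w)]

/-- A choice of a basis vector in each factor. -/
abbrev Config : Type _ := (w : W) → BasisIndex (Q w)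

/-- The Hilbert space tensor product of a finite family of Hilbert spaces, realized as the space of
square-summable coefficient families with respect to the product basis. The elementary tensors are
given by `tprod`; by `inner_tprod` and `span_tprod_dense` this is the Hilbert tensor product. -/
abbrev PiTensor : Type _ := ℓ²(Config Q, ℂ)

/-- The tensor product of the factors in `S`. -/
abbrev SubTensor (S : Finset W) : Type _ := PiTensor (fun w : {w // w ∈ S} => Q w)

variable {Q}

theorem summable_sq {ι : Type*} (f : ℓ²(ι, ℂ)) : Summable fun i => ‖f i‖ ^ 2 := by
  simpa using (lp.memℓp f).summable (by norm_num)

theorem norm_sq_eq {ι : Type*} (f : ℓ²(ι, ℂ)) : ‖f‖ ^ 2 = ∑' i, ‖f i‖ ^ 2 := by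
  simpa using lp.norm_rpow_eq_tsum (p := 2) (by norm_num) f

theorem memlp_two {ι : Type*} {f : ι → ℂ} (h : Summable fun i => ‖f i‖ ^ 2) :
    Memℓp (E := fun _ => ℂ) f 2 :=
  memℓp_gen (by simpa using h)

theorem norm_coeff_summable {K : Type*} [NormedAddCommGroup K] [InnerProductSpace ℂ K]
    [CompleteSpace K] (x y : K) :
    Summable fun i => ‖inner ℂ x (basis K i) * inner ℂ (basis K i) y‖ := by
  have h := summable_sq ((basis K).repr x)
  have h' := summable_sq ((basis K).repr y)
  refine Summable.of_nonneg_of_le (fun _ => norm_nonneg _) (fun i => ?_) (h.add h')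
  rw [norm_mul, (basis K).repr_apply_apply, (basis K).repr_apply_apply, norm_inner_symm x]
  nlinarith [sq_nonneg (‖inner ℂ (basis K i) x‖ - ‖inner ℂ (basis K i) y‖),
    sq_nonneg ‖inner ℂ (basis K i) x‖, sq_nonneg ‖inner ℂ (basis K i) y‖]

theorem summable_tprod [Fintype W] (x : (w : W) → Q w) :
    Summable fun t : Config Q => ‖∏ w, inner ℂ (basis (Q w) (t w)) (x w)‖ ^ 2 := by
  have h := (piP_all W (ι := fun w => BasisIndex (Q w))
    (fun w i => inner ℂ (x w) (basis (Q w) i) * inner ℂ (basis (Q w) i) (x w))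
    (fun w => norm_coeff_summable (x w) (x w))).1
  refine h.congr fun t => ?_
  simp_rw [Finset.prod_mul_distrib, norm_mul, norm_prod, sq, norm_inner_symm (x _)]

/-- The elementary tensor `⨂ w, x w`. -/
def tprod [Fintype W] (x : (w : W) → Q w) : PiTensor Q :=
  ⟨fun t => ∏ w, inner ℂ (basis (Q w) (t w)) (x w), memlp_two (summable_tprod x)⟩

theorem inner_tprod [Fintype W] (x y : (w : W) → Q w) :
    inner ℂ (tprod x) (tprod y) = ∏ w, inner ℂ (x w) (y w) := by
  have h := (piP_all W (ι := fun w => BasisIndex (Q w))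
    (fun w i => inner ℂ (x w) (basis (Q w) i) * inner ℂ (basis (Q w) i) (y w))
    (fun w => norm_coeff_summable (x w) (y w))).2
  simp_rw [HilbertBasis.tsum_inner_mul_inner] at h
  rw [← h, lp.inner_eq_tsum]
  refine tsum_congr fun t => ?_
  simp only [tprod, RCLike.inner_apply, map_prod, inner_conj_symm, Finset.prod_mul_distrib]
  rw [mul_comm]

theorem span_tprod_dense [Fintype W] :
    (Submodule.span ℂ (Set.range (tprod : ((w : W) → Q w) → PiTensor Q))).topologicalClosure = ⊤ := by
  classical
  rw [Submodule.topologicalClosure_eq_top_iff, Submodule.eq_bot_iff]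
  intro f hf
  ext t
  have h1 : tprod (fun w => basis (Q w) (t w)) = lp.single 2 t (1 : ℂ) := by
    ext s
    simp only [tprod, lp.coeFn_single]
    by_cases hst : s = t
    · subst hst
      rw [Pi.single_eq_same]
      exact Finset.prod_eq_one fun w _ => by
        simp [inner_self_eq_norm_sq_to_K, (basis (Q w)).orthonormal.1 (s w)]
    · obtain ⟨w, hw⟩ := Function.ne_iff.1 hst
      rw [Pi.single_eq_of_ne hst]
      exact Finset.prod_eq_zero (Finset.mem_univ w)
        ((basis (Q w)).orthonormal.inner_eq_zero hw)
  have h2 := (Submodule.mem_orthogonal _ _).1 hf _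
    (Submodule.subset_span ⟨fun w => basis (Q w) (t w), rfl⟩)
  rw [h1, lp.inner_single_left] at h2
  simpa using h2

variable [DecidableEq W]

/-- A configuration of all factors, as a configuration of the factors in `S` together with one of
the other factors. -/
def splitConfig (Q : W → Type*) [∀ w, NormedAddCommGroup (Q w)]
    [∀ w, InnerProductSpace ℂ (Q w)] [∀ w, CompleteSpace (Q w)] (S : Finset W) :
    Config Q ≃ Config (fun w : {w // w ∈ S} => Q w) × Config (fun w : {w // w ∉ S} => Q w) :=
  Equiv.piEquivPiSubtypeProd (fun w => w ∈ S) (fun w => BasisIndex (Q w))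

/-- The vector of `⨂ w ∈ S, Q w` whose coefficients are those of `f` at configurations that agree
with `e` outside `S`. -/
def slice (S : Finset W) (f : PiTensor Q) (e : Config (fun w : {w // w ∉ S} => Q w)) :
    SubTensor Q S :=
  ⟨fun s => f ((splitConfig Q S).symm (s, e)), memlp_two <|
    (summable_sq f).comp_injective (i := fun s => (splitConfig Q S).symm (s, e))
      fun s s' h => by simpa using h⟩

theorem hasSum_norm_slice (S : Finset W) (f : PiTensor Q) :
    HasSum (fun e => ‖slice S f e‖ ^ 2) (‖f‖ ^ 2) := by
  have h1 : HasSum (fun t => ‖f t‖ ^ 2) (‖f‖ ^ 2) := by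
    rw [norm_sq_eq]; exact (summable_sq f).hasSum
  have h2 := ((splitConfig Q S).symm.hasSum_iff).2 h1
  have h3 := ((Equiv.prodComm _ _).hasSum_iff).2 h2
  refine h3.prod_fiberwise fun e => ?_
  rw [norm_sq_eq]
  exact (summable_sq (slice S f e)).hasSum

theorem hasSum_amplify (S : Finset W) (L : SubTensor Q S →L[ℂ] SubTensor Q S) (f : PiTensor Q) :
    Summable (fun t => ‖L (slice S f (splitConfig Q S t).2) (splitConfig Q S t).1‖ ^ 2) ∧
    ∑' t, ‖L (slice S f (splitConfig Q S t).2) (splitConfig Q S t).1‖ ^ 2 ≤ (‖L‖ * ‖f‖) ^ 2 := by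
  have hle : ∀ e, ‖L (slice S f e)‖ ^ 2 ≤ ‖L‖ ^ 2 * ‖slice S f e‖ ^ 2 := fun e => by
    rw [← mul_pow]; gcongr; exact L.le_opNorm _
  have hs := (hasSum_norm_slice S f).mul_left (‖L‖ ^ 2)
  have hs' : Summable fun e => ‖L (slice S f e)‖ ^ 2 :=
    Summable.of_nonneg_of_le (fun e => by positivity) hle hs.summable
  let g : Config (fun w : {w // w ∉ S} => Q w) × Config (fun w : {w // w ∈ S} => Q w) → ℝ :=
    fun p => ‖L (slice S f p.1) p.2‖ ^ 2
  have hg : Summable g := by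
    refine (summable_prod_of_nonneg fun p => by positivity).2 ⟨fun e => summable_sq (L (slice S f e)), ?_⟩
    exact hs'.congr fun e => norm_sq_eq (L (slice S f e))
  let φ := (splitConfig Q S).trans (Equiv.prodComm _ _)
  refine ⟨(φ.summable_iff (f := g)).2 hg, ?_⟩
  have h1 : ∑' t, ‖L (slice S f (splitConfig Q S t).2) (splitConfig Q S t).1‖ ^ 2 = ∑' p, g p :=
    φ.tsum_eq g
  rw [h1, hg.tsum_prod, mul_pow, ← hs.tsum_eq]
  have h2 : ∀ e, ∑' s, g (e, s) = ‖L (slice S f e)‖ ^ 2 := fun e =>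
    (norm_sq_eq (L (slice S f e))).symm
  simp_rw [h2]
  exact Summable.tsum_le_tsum hle hs' hs.summable

/-- The operator `L ⊗ 1` on `⨂ w, Q w`, where `L` acts on the factors in `S` and the identity on the
others. -/
def amplify (S : Finset W) (L : SubTensor Q S →L[ℂ] SubTensor Q S) : PiTensor Q →L[ℂ] PiTensor Q :=
  LinearMap.mkContinuous
    { toFun := fun f => ⟨fun t => L (slice S f (splitConfig Q S t).2) (splitConfig Q S t).1,
        memlp_two (hasSum_amplify S L f).1⟩
      map_add' := fun f g => by
        ext t
        have h : ∀ e, slice S (f + g) e = slice S f e + slice S g e := fun e => rfl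
        change L (slice S (f + g) _) _ = L (slice S f _) _ + L (slice S g _) _
        rw [h, map_add]; rfl
      map_smul' := fun c f => by
        ext t
        have h : ∀ e, slice S (c • f) e = c • slice S f e := fun e => rfl
        change L (slice S (c • f) _) _ = c • L (slice S f _) _
        rw [h, map_smul]; rfl }
    ‖L‖ fun f => by
      refine (pow_le_pow_iff_left₀ (by positivity) (by positivity) two_ne_zero).1 ?_
      rw [norm_sq_eq]
      exact (hasSum_amplify S L f).2

/-- `amplify S L` sends `⨂ w, x w` to `L (⨂ w ∈ S, x w) ⊗ ⨂ w ∉ S, x w`. -/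
theorem amplify_tprod [Fintype W] (S : Finset W) (L : SubTensor Q S →L[ℂ] SubTensor Q S)
    (x : (w : W) → Q w) (t : Config Q) :
    amplify S L (tprod x) t =
      L (tprod fun w : {w // w ∈ S} => x w) (splitConfig Q S t).1 *
        (tprod fun w : {w // w ∉ S} => x w) (splitConfig Q S t).2 := by
  have h : ∀ e, slice S (tprod x) e =
      (tprod fun w : {w // w ∉ S} => x w) e • (tprod fun w : {w // w ∈ S} => x w) := by
    intro e
    ext s
    change ∏ w, inner ℂ (basis (Q w) ((splitConfig Q S).symm (s, e) w)) (x w) =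
      (∏ w : {w // w ∉ S}, inner ℂ (basis (Q w) (e w)) (x w)) *
        ∏ w : {w // w ∈ S}, inner ℂ (basis (Q w) (s w)) (x w)
    rw [mul_comm, ← Fintype.prod_subtype_mul_prod_subtype (fun w => w ∈ S)]
    congr 1
    · refine Finset.prod_congr (by ext; simp) fun w _ => ?_
      simp [splitConfig, Equiv.piEquivPiSubtypeProd, w.2]
    · refine Finset.prod_congr (by ext; simp) fun w _ => ?_
      simp [splitConfig, Equiv.piEquivPiSubtypeProd, w.2]
  change L (slice S (tprod x) _) _ = _
  rw [h, map_smul, mul_comm]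
  rfl

end Family

/-! ### Quantum circuits -/

section Circuits

variable {Wire : Type*} [DecidableEq Wire] (Q : Wire → Type*) [∀ w, NormedAddCommGroup (Q w)]
  [∀ w, InnerProductSpace ℂ (Q w)] [∀ w, CompleteSpace (Q w)] (Gate : Type*)

/-- A quantum circuit with a fixed execution schedule. The quantum wires `w` carry Hilbert spaces
`Q w`, and every gate acts on some of the wires; on each wire, the gates act in the order of the
schedule (so gates that share a wire are fired at different stages, and the earlier one is a quantum
prerequisite of the later one). Classical channels carry outcomes from gate to gate. -/
structure Circuit where
  /-- The quantum wires on which a gate acts. -/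
  wires : Gate → Finset Wire
  /-- The classical sources of a gate. -/
  sources : Gate → Finset Gate
  /-- The number of stages of the schedule. -/
  depth : ℕ
  /-- The stage of the schedule at which a gate is fired. -/
  stage : Gate → Fin depth
  /-- The gates that are fired simultaneously act on different wires. -/
  disjoint_wires : ∀ F G, F ≠ G → stage F = stage G → Disjoint (wires F) (wires G)
  /-- The classical sources of a gate are fired before it. -/
  stage_lt : ∀ G, ∀ F ∈ sources G, stage F < stage G
  /-- The (names of the) measurements assigned to a gate. -/
  Choice : Gate → Type
  choice_finite : ∀ G, Finite (Choice G)
  choice_nonempty : ∀ G, Nonempty (Choice G)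
  /-- The outcomes of a measurement assigned to a gate. Outcomes of different measurements of a gate
  are distinguished by carrying the name of their measurement. -/
  Result : (G : Gate) → Choice G → Type
  result_countable : ∀ G c, Countable (Result G c)
  /-- The measurements assigned to a gate; a unitary gate has a single one-outcome measurement. -/
  measurement : ∀ G c, Measurement (Result G c) (SubTensor Q (wires G))
  /-- The selection function of a gate: it picks the measurement to be executed, given the outcomes
  at the classical sources. -/
  select : (G : Gate) → ((F : {F // F ∈ sources G}) → (Σ c : Choice F, Result F c)) → Choice G
  /-- There are no superfluous measurements. -/
  select_surjective : ∀ G, Function.Surjective (select G)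

variable {Q Gate}

namespace Circuit

/-- The outcomes of all measurements assigned to the gate `G`. -/
abbrev Outcome (C : Circuit Q Gate) (G : Gate) : Type := Σ c : C.Choice G, C.Result G c

/-- A computation path: an assignment to every gate of an outcome of the measurement picked by the
selection function. -/
structure Path (C : Circuit Q Gate) where
  outcome : (G : Gate) → C.Outcome G
  coherent : ∀ G, (outcome G).1 = C.select G fun F => outcome F

/-- The operator, on the tensor product of all wires, of an outcome of a gate. -/
def gateOp (C : Circuit Q Gate) (G : Gate) (o : C.Outcome G) : PiTensor Q →L[ℂ] PiTensor Q :=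
  amplify (C.wires G) ((C.measurement G o.1).op o.2)

variable [Fintype Gate] [LinearOrder Gate]

/-- The gates fired at stage `n`, listed in the linear order of the gates. -/
def bout (C : Circuit Q Gate) (n : ℕ) : List Gate :=
  (Finset.univ.filter fun G => (C.stage G : ℕ) = n).sort (· ≤ ·)

/-- The operator of the outcome, along the path `μ`, of the tensor product of the measurements
executed at stage `n`. As simultaneous gates act on different wires, this tensor product of
operators is the product of the operators of the single gates, in any order. -/
def boutOp (C : Circuit Q Gate) (μ : C.Path) (n : ℕ) : PiTensor Q →L[ℂ] PiTensor Q :=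
  ((C.bout n).map fun G => C.gateOp G (μ.outcome G)).prod

/-- The (not normalized) state after the first `n` stages of a computation along `μ` on the initial
state `σ`: an outcome with operator `L` turns a state `τ` into `L τ L†`. -/
def stateAfter (C : Circuit Q Gate) (μ : C.Path) (σ : PiTensor Q →L[ℂ] PiTensor Q) :
    ℕ → (PiTensor Q →L[ℂ] PiTensor Q)
  | 0 => σ
  | n + 1 => C.boutOp μ n ∘L C.stateAfter μ σ n ∘L ContinuousLinearMap.adjoint (C.boutOp μ n)

/-- The probability that the measurement of stage `n` produces the outcome prescribed by `μ`, in the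
state reached by following `μ` up to there (zero if that point is never reached). -/
def stageProb (C : Circuit Q Gate) (μ : C.Path) (σ : PiTensor Q →L[ℂ] PiTensor Q) (n : ℕ) :
    ℝ≥0∞ :=
  trace (C.stateAfter μ σ (n + 1)) / trace (C.stateAfter μ σ n)

variable {H A : Type*} [NormedAddCommGroup H] [InnerProductSpace ℂ H] [CompleteSpace H]
  [NormedAddCommGroup A] [InnerProductSpace ℂ A] [CompleteSpace A]

/-- A state of `H ⊗ A` as a state of the wires, under an identification `e` of the tensor product of
the wires with `H ⊗ A`. -/
def toWires (e : PiTensor Q ≃ₗᵢ[ℂ] HTensor H A) (σ : HTensor H A →L[ℂ] HTensor H A) :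
    PiTensor Q →L[ℂ] PiTensor Q :=
  (e.symm.toContinuousLinearEquiv : HTensor H A →L[ℂ] PiTensor Q) ∘L σ ∘L
    (e.toContinuousLinearEquiv : PiTensor Q →L[ℂ] HTensor H A)

/-- A state of the wires as a state of `H ⊗ A`. -/
def ofWires (e : PiTensor Q ≃ₗᵢ[ℂ] HTensor H A) (τ : PiTensor Q →L[ℂ] PiTensor Q) :
    HTensor H A →L[ℂ] HTensor H A :=
  (e.toContinuousLinearEquiv : PiTensor Q →L[ℂ] HTensor H A) ∘L τ ∘L
    (e.symm.toContinuousLinearEquiv : HTensor H A →L[ℂ] PiTensor Q)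

/-- The output on `H ⊗ A` of the computation along `μ` on principal input `ρ`, the ancillas being
initialized in the state `a`. -/
def output (C : Circuit Q Gate) (e : PiTensor Q ≃ₗᵢ[ℂ] HTensor H A) (a : A) (μ : C.Path)
    (ρ : H →L[ℂ] H) : HTensor H A →L[ℂ] HTensor H A :=
  ofWires e (C.stateAfter μ (toWires e (fullInput a ρ)) C.depth)

/-- The probability that the computation on principal input `ρ` follows the path `μ`. -/
def pathProb (C : Circuit Q Gate) (e : PiTensor Q ≃ₗᵢ[ℂ] HTensor H A) (a : A) (μ : C.Path)
    (ρ : H →L[ℂ] H) : ℝ≥0∞ :=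
  ∏ n ∈ Finset.range C.depth, C.stageProb μ (toWires e (fullInput a ρ)) n

/-- The probability that the computation on principal input `ρ` follows some path in `𝒢`. -/
def followProb (C : Circuit Q Gate) (e : PiTensor Q ≃ₗᵢ[ℂ] HTensor H A) (a : A)
    (𝒢 : Set C.Path) (ρ : H →L[ℂ] H) : ℝ≥0∞ :=
  ∑' μ : 𝒢, C.pathProb e a μ ρ

/-- The circuit computes `U` along the path `μ`: whenever the computation on principal input `ρ` can
follow `μ`, its principal output represents the same state as `U ρ U†`. -/
def ComputesAlong (C : Circuit Q Gate) (e : PiTensor Q ≃ₗᵢ[ℂ] HTensor H A) (a : A) (μ : C.Path)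
    (U : H →L[ℂ] H) : Prop :=
  ∀ ρ : H →L[ℂ] H, IsDensityOperator ρ → C.pathProb e a μ ρ ≠ 0 →
    SameState (partialTrace (C.output e a μ ρ)) (U ∘L ρ ∘L ContinuousLinearMap.adjoint U)

end Circuit

end Circuits

end QCircuit
end

noncomputable section

set_option linter.unusedSectionVars false

namespace QCircuit

open ContinuousLinearMap InnerProductSpace

/-! ### Hilbert–Schmidt norms and traces -/

section HilbertSchmidt

variable {E F G : Type*} [NormedAddCommGroup E] [InnerProductSpace ℂ E] [CompleteSpace E]
  [NormedAddCommGroup F] [InnerProductSpace ℂ F] [CompleteSpace F]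
  [NormedAddCommGroup G] [InnerProductSpace ℂ G] [CompleteSpace G]

/-! Along a fixed path the circuit acts on principal inputs by one operator `V` from `H` to the
wires, the product of all outcome operators after `x ↦ x ⊗ a` (`runOp`). Writing `ρ = X X†`, the
unnormalized state stays of the form `(V X)(V X)†`, and the stage probabilities telescope to `‖V X‖²
/ ‖X‖²` in Hilbert–Schmidt norms (`pathProb_comp_adjoint`). So it suffices that `V` is a multiple of
an isometry, `‖V x‖² = c ‖x‖²`: then the path has probability `c` on every input, and each term of
the sum over paths is constant.

Pure inputs are enough to see this (`norm_sq_eq_of_partialTrace_rankOne`). Expand `V x = ∑ j, V_j x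
⊗ e_j` in a basis of `A`. The partial trace of the output is `∑ j, |V_j x⟩⟨V_j x|`, a sum of
positive operators. If it is proportional to `|U x⟩⟨U x|`, every `V_j x` is a multiple of `U x`.
Hence every vector is an eigenvector of `U† V_j`, so `V_j = c_j U` with `c_j` independent of `x`,
and `c = ∑ j, |c_j|²`. -/

theorem hasSum_norm_inner_sq {ι : Type*} (b : HilbertBasis ι ℂ E) (x : E) :
    HasSum (fun i => ‖inner ℂ (b i) x‖ ^ 2) (‖x‖ ^ 2) := by
  have h := (summable_sq (b.repr x)).hasSum
  rw [← norm_sq_eq, LinearIsometryEquiv.norm_map] at h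
  simpa only [b.repr_apply_apply] using h

theorem ofReal_norm_sq_eq_tsum {ι : Type*} (b : HilbertBasis ι ℂ E) (x : E) :
    ENNReal.ofReal (‖x‖ ^ 2) = ∑' i, ENNReal.ofReal (‖inner ℂ (b i) x‖ ^ 2) := by
  have h := hasSum_norm_inner_sq b x
  rw [← h.tsum_eq, ENNReal.ofReal_tsum_of_nonneg (fun _ => by positivity) h.summable]

/-- The square of the Hilbert–Schmidt norm of an operator. -/
def hsNormSq (X : E →L[ℂ] F) : ℝ≥0∞ := ∑' i, ENNReal.ofReal (‖X (basis E i)‖ ^ 2)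

/-- Both sides are the double sum of the squared moduli of the matrix entries; in `[0, ∞]` the order
of summation is immaterial. -/
theorem hsNormSq_adjoint (X : E →L[ℂ] F) : hsNormSq (adjoint X) = hsNormSq X := by
  unfold hsNormSq
  simp_rw [ofReal_norm_sq_eq_tsum (basis E) (adjoint X _), ofReal_norm_sq_eq_tsum (basis F) (X _)]
  rw [ENNReal.tsum_comm]
  simp_rw [adjoint_inner_right, norm_inner_symm]

theorem trace_comp_adjoint (X : E →L[ℂ] F) : trace (X ∘L adjoint X) = hsNormSq X := by
  rw [← hsNormSq_adjoint]
  refine tsum_congr fun i => ?_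
  rw [comp_apply, ← adjoint_inner_left, inner_self_eq_norm_sq]

theorem hsNormSq_comp_le (L : F →L[ℂ] G) (X : E →L[ℂ] F) :
    hsNormSq (L ∘L X) ≤ ENNReal.ofReal (‖L‖ ^ 2) * hsNormSq X := by
  unfold hsNormSq
  rw [← ENNReal.tsum_mul_left]
  refine ENNReal.tsum_le_tsum fun i => ?_
  rw [← ENNReal.ofReal_mul (by positivity), ← mul_pow]
  gcongr
  exact L.le_opNorm _

theorem hsNormSq_comp_of_norm_sq_eq {c : ℝ} (hc : 0 ≤ c) {V : F →L[ℂ] G}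
    (hV : ∀ x, ‖V x‖ ^ 2 = c * ‖x‖ ^ 2) (X : E →L[ℂ] F) :
    hsNormSq (V ∘L X) = ENNReal.ofReal c * hsNormSq X := by
  unfold hsNormSq
  simp_rw [comp_apply, hV, ENNReal.ofReal_mul hc, ENNReal.tsum_mul_left]

theorem hsNormSq_eq_zero_iff {X : E →L[ℂ] F} : hsNormSq X = 0 ↔ X = 0 := by
  refine ⟨fun h => ?_, fun h => by simp [h, hsNormSq]⟩
  rw [hsNormSq, ENNReal.tsum_eq_zero] at h
  refine ContinuousLinearMap.ext_on ((dense_iff_closure_eq.2 <|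
    congrArg SetLike.coe (basis E).dense_span)) ?_
  rintro _ ⟨i, rfl⟩
  simpa using h i

/-- Applying an outcome to a state `X X†` amounts to composing `X` with the operator of the outcome.
This replaces any use of cyclicity of the trace. -/
theorem conj_comp_adjoint (L : F →L[ℂ] G) (X : E →L[ℂ] F) :
    L ∘L (X ∘L adjoint X) ∘L adjoint L = (L ∘L X) ∘L adjoint (L ∘L X) := by
  rw [adjoint_comp]; rfl

/-! ### Factorization of density operators; pure states -/

theorem IsDensityOperator.exists_eq_comp_adjoint {ρ : E →L[ℂ] E} (hρ : IsDensityOperator ρ) :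
    ∃ X : E →L[ℂ] E, ρ = X ∘L adjoint X ∧ hsNormSq X ≠ 0 ∧ hsNormSq X ≠ ⊤ := by
  obtain ⟨S, hS⟩ := CStarAlgebra.nonneg_iff_eq_star_mul_self.1
    ((nonneg_iff_isPositive ρ).2 hρ.isPositive)
  have h : ρ = adjoint S ∘L adjoint (adjoint S) := by
    rw [adjoint_adjoint]; exact hS
  refine ⟨adjoint S, h, fun h0 => hρ.ne_zero ?_, ?_⟩
  · rw [h, hsNormSq_eq_zero_iff.1 h0, zero_comp]
  · rw [← trace_comp_adjoint, ← h]; exact hρ.trace_ne_top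

theorem hsNormSq_toSpanSingleton (x : E) :
    hsNormSq (toSpanSingleton ℂ x) = ENNReal.ofReal (‖x‖ ^ 2) := by
  have h : adjoint (toSpanSingleton ℂ x) = innerSL ℂ x := by
    rw [← adjoint_innerSL_apply, adjoint_adjoint]
  -- Passing to the adjoint moves the sum from the unspecified basis of `ℂ` to the basis of `E`,
  -- where it is Parseval's identity.
  rw [← hsNormSq_adjoint, ofReal_norm_sq_eq_tsum (basis E) x, h]
  exact tsum_congr fun i => by rw [innerSL_apply_apply, norm_inner_symm]

theorem rankOne_self_eq_comp_adjoint (x : E) :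
    rankOne ℂ x x = toSpanSingleton ℂ x ∘L adjoint (toSpanSingleton ℂ x) := by
  rw [rankOne_def', ← adjoint_innerSL_apply, adjoint_adjoint]

theorem comp_rankOne_comp_adjoint (L : E →L[ℂ] F) (x : E) :
    L ∘L rankOne ℂ x x ∘L adjoint L = rankOne ℂ (L x) (L x) := by
  rw [rankOne_comp, adjoint_adjoint, comp_rankOne]

theorem isDensityOperator_rankOne_self {x : E} (hx : x ≠ 0) :
    IsDensityOperator (rankOne ℂ x x) where
  ne_zero := by simpa using hx
  isPositive := isPositive_rankOne_self x
  trace_ne_top := by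
    rw [rankOne_self_eq_comp_adjoint, trace_comp_adjoint, hsNormSq_toSpanSingleton]
    exact ENNReal.ofReal_ne_top

end HilbertSchmidt

/-! ### Operators with many eigenvectors -/

theorem exists_eq_smul_of_forall_eigenvector {K V : Type*} [Field K] [AddCommGroup V] [Module K V]
    (f : V →ₗ[K] V) (hf : ∀ x, ∃ c : K, f x = c • x) : ∃ c : K, ∀ x, f x = c • x := by
  by_cases hV : ∃ x : V, x ≠ 0
  · obtain ⟨x, hx⟩ := hV
    obtain ⟨c, hc⟩ := hf x
    refine ⟨c, fun y => ?_⟩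
    by_cases hy : ∃ t : K, t • x = y
    · obtain ⟨t, rfl⟩ := hy
      rw [map_smul, hc, smul_comm]
    · have hli : LinearIndependent K ![x, y] :=
        (LinearIndependent.pair_iff' hx).2 fun t ht => hy ⟨t, ht⟩
      -- For independent `x` and `y`, comparing coefficients in `f (x + y) = d • (x + y) = c • x +
      -- c' • y` forces `c = d = c'`.
      obtain ⟨c', hc'⟩ := hf y
      obtain ⟨d, hd⟩ := hf (x + y)
      rw [map_add, hc, hc', smul_add] at hd
      obtain ⟨h1, h2⟩ := LinearIndependent.pair_iff.1 hli (c - d) (c' - d) (by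
        rw [sub_smul, sub_smul, add_comm, sub_add_sub_comm, add_comm (c' • y), hd,
          add_comm (d • y), sub_self])
      rw [hc', sub_eq_zero.1 h2, sub_eq_zero.1 h1]
  · push Not at hV
    exact ⟨0, fun x => by rw [hV x]; simp⟩

/-! ### The tensor product of two Hilbert spaces -/

section Tensor

variable {H A : Type*} [NormedAddCommGroup H] [InnerProductSpace ℂ H] [CompleteSpace H]
  [NormedAddCommGroup A] [InnerProductSpace ℂ A] [CompleteSpace A]

theorem tensorRight_apply (v : A) (x : H) :
    tensorRight H v x = ((x ⊗ₜ[ℂ] v : H ⊗[ℂ] A) : HTensor H A) := rfl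

theorem inner_tensorRight (v w : A) (x y : H) :
    inner ℂ (tensorRight H v x) (tensorRight H w y) = inner ℂ x y * inner ℂ v w := by
  rw [tensorRight_apply, tensorRight_apply, UniformSpace.Completion.inner_coe,
    TensorProduct.inner_tmul]

theorem norm_tensorRight {v : A} (hv : ‖v‖ = 1) (x : H) : ‖tensorRight H v x‖ = ‖x‖ := by
  rw [tensorRight_apply, UniformSpace.Completion.norm_coe, TensorProduct.norm_tmul, hv, mul_one]

variable (H A) in
/-- The elementary tensors of basis vectors. -/
def tensorVec (p : BasisIndex A × BasisIndex H) : HTensor H A :=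
  tensorRight H (basis A p.1) (basis H p.2)

theorem orthonormal_tensorVec : Orthonormal ℂ (tensorVec H A) := by
  classical
  rw [orthonormal_iff_ite]
  rintro ⟨j, i⟩ ⟨j', i'⟩
  rw [tensorVec, tensorVec, inner_tensorRight, orthonormal_iff_ite.1 (basis H).orthonormal,
    orthonormal_iff_ite.1 (basis A).orthonormal]
  simp only [Prod.mk.injEq]
  split_ifs <;> simp_all

theorem eq_zero_of_forall_inner_basis {E : Type*} [NormedAddCommGroup E] [InnerProductSpace ℂ E]
    [CompleteSpace E] {x : E} (h : ∀ i, inner ℂ (basis E i) x = 0) : x = 0 := by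
  have := (hasSum_norm_inner_sq (basis E) x).tsum_eq
  simpa [h] using this.symm

/-- Orthogonality to `w` extends from basis vectors to arbitrary ones in one tensor slot at a time,
since each slot is a bounded linear map; then to the algebraic tensor product by linearity and to
its completion by continuity. -/
theorem eq_zero_of_forall_inner_tensorVec {w : HTensor H A}
    (h : ∀ p, inner ℂ (tensorVec H A p) w = 0) : w = 0 := by
  have h1 : ∀ (x : H) (j), inner ℂ (tensorRight H (basis A j) x) w = 0 := fun x j => by
    rw [← adjoint_inner_right, eq_zero_of_forall_inner_basis (x := adjoint _ w) fun i => ?_, inner_zero_right]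
    rw [adjoint_inner_right]
    exact h (j, i)
  have h2 : ∀ (x : H) (v : A), inner ℂ (tensorRight H v x) w = 0 := fun x v => by
    let T : A →L[ℂ] HTensor H A := UniformSpace.Completion.toComplL ∘L TensorProduct.mkL ℂ H A x
    change inner ℂ (T v) w = 0
    rw [← adjoint_inner_right, eq_zero_of_forall_inner_basis (x := adjoint T w) fun j => ?_, inner_zero_right]
    rw [adjoint_inner_right]
    exact h1 x j
  have h3 : ∀ z : H ⊗[ℂ] A, inner ℂ (z : HTensor H A) w = 0 := fun z => by
    induction z with
    | zero => rw [UniformSpace.Completion.coe_zero, inner_zero_left]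
    | tmul x v => exact h2 x v
    | add y z hy hz => rw [UniformSpace.Completion.coe_add, inner_add_left, hy, hz, add_zero]
  have h4 : ∀ z : HTensor H A, inner ℂ z w = 0 := fun z => by
    induction z using UniformSpace.Completion.induction_on with
    | hp => exact isClosed_eq (by fun_prop) continuous_const
    | ih z => exact h3 z
  exact inner_self_eq_zero.1 (h4 w)

variable (H A) in
/-- The Hilbert basis of `H ⊗ A` that consists of the elementary tensors of basis vectors. -/
def tensorBasis : HilbertBasis (BasisIndex A × BasisIndex H) ℂ (HTensor H A) :=
  HilbertBasis.mkOfOrthogonalEqBot orthonormal_tensorVec <| by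
    rw [Submodule.eq_bot_iff]
    intro w hw
    exact eq_zero_of_forall_inner_tensorVec fun p =>
      (Submodule.mem_orthogonal _ _).1 hw _ (Submodule.subset_span ⟨p, rfl⟩)

/-- Parseval for the product basis, grouped by the index of `A`: the vectors are the components
`w_j` in `w = ∑ j, w_j ⊗ e_j`. -/
theorem hasSum_norm_adjoint_tensorRight (w : HTensor H A) :
    HasSum (fun j => ‖adjoint (tensorRight H (basis A j)) w‖ ^ 2) (‖w‖ ^ 2) := by
  refine (hasSum_norm_inner_sq (tensorBasis H A) w).prod_fiberwise fun j => ?_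
  convert hasSum_norm_inner_sq (basis H) (adjoint (tensorRight H (basis A j)) w) using 4 with i
  rw [tensorBasis, HilbertBasis.coe_mkOfOrthogonalEqBot, adjoint_inner_right]
  rfl

/-- `partialTrace` is a `tsum`, hence meaningful only once convergence is known. Here it converges
absolutely in norm, as the norms of the terms are the `‖w_j‖²`, which add up to `‖w‖²`. -/
theorem hasSum_partialTrace_rankOne_self (w : HTensor H A) :
    HasSum (fun j => rankOne ℂ (adjoint (tensorRight H (basis A j)) w)
      (adjoint (tensorRight H (basis A j)) w)) (partialTrace (rankOne ℂ w w)) := by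
  have h : Summable fun j => rankOne ℂ (adjoint (tensorRight H (basis A j)) w)
      (adjoint (tensorRight H (basis A j)) w) :=
    .of_norm <| by simpa only [norm_rankOne, ← sq] using (hasSum_norm_adjoint_tensorRight w).summable
  convert h.hasSum using 1
  refine tsum_congr fun j => ?_
  rw [rankOne_comp, comp_rankOne]

theorem norm_sq_eq_of_partialTrace_rankOne {V : H →L[ℂ] HTensor H A} {U : H →L[ℂ] H}
    (hU : U ∈ unitary (H →L[ℂ] H))
    (h : ∀ x, V x ≠ 0 → SameState (partialTrace (rankOne ℂ (V x) (V x))) (rankOne ℂ (U x) (U x))) :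
    ∃ c : ℝ, 0 ≤ c ∧ ∀ x, ‖V x‖ ^ 2 = c * ‖x‖ ^ 2 := by
  have hUU : ∀ x, adjoint U (U x) = x := fun x => congr($((Unitary.mem_iff.1 hU).1) x)
  have hU' : ∀ x, U (adjoint U x) = x := fun x => congr($((Unitary.mem_iff.1 hU).2) x)
  have hnorm : ∀ x, ‖U x‖ = ‖x‖ := (norm_map_iff_adjoint_comp_self U).2 (Unitary.mem_iff.1 hU).1
  have hmem : ∀ j x, adjoint (tensorRight H (basis A j)) (V x) ∈ Submodule.span ℂ {U x} := by
    intro j x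
    by_cases hx : V x = 0
    · rw [hx, map_zero]; exact zero_mem _
    obtain ⟨c, -, hc⟩ := h x hx
    -- A line is its own double orthogonal complement, so it suffices to test against `y ⟂ U x`. The
    -- partial trace has `⟨y, T y⟩ = 0` there, while the same number is a sum of squares `|⟨w_j,
    -- y⟩|²`; all of them vanish.
    rw [← Submodule.orthogonal_orthogonal (Submodule.span ℂ {U x}), Submodule.mem_orthogonal]
    intro y hy
    have hy' : inner ℂ (U x) y = 0 := Submodule.mem_orthogonal_singleton_iff_inner_right.1 hy
    have hs := (hasSum_partialTrace_rankOne_self (V x)).mapL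
      (((innerSL ℂ y).comp (ContinuousLinearMap.apply ℂ H y)))
    have hs' : HasSum (fun j => ‖inner ℂ (adjoint (tensorRight H (basis A j)) (V x)) y‖ ^ 2) 0 := by
      have := Complex.hasSum_re hs
      simp only [hc, comp_apply, apply_apply, innerSL_apply_apply, rankOne_apply, inner_smul_right,
        smul_apply, hy', zero_smul, smul_zero, inner_zero_right,
        Complex.zero_re] at this
      refine this.congr_fun fun j => ?_
      rw [← inner_conj_symm y, RCLike.mul_conj]
      norm_cast
    have := (hasSum_zero_iff_of_nonneg fun j => by positivity).1 hs'
    exact inner_eq_zero_symm.1 (by simpa using congrFun this j)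
  have hscalar : ∀ j, ∃ c : ℂ, ∀ x, adjoint (tensorRight H (basis A j)) (V x) = c • U x := by
    intro j
    obtain ⟨c, hc⟩ := exists_eq_smul_of_forall_eigenvector
      (adjoint U ∘L adjoint (tensorRight H (basis A j)) ∘L V).toLinearMap fun x => by
        obtain ⟨c, hc⟩ := Submodule.mem_span_singleton.1 (hmem j x)
        exact ⟨c, by simp [← hc, hUU]⟩
    refine ⟨c, fun x => ?_⟩
    rw [← hU' (adjoint _ _), ← map_smul, ← hc x]
    rfl
  choose c hc using hscalar
  -- Convergence of this sum need not be checked: `tsum_mul_right` holds in a field without it, and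
  -- the two series agree term by term.
  refine ⟨∑' j, ‖c j‖ ^ 2, tsum_nonneg fun j => by positivity, fun x => ?_⟩
  rw [← (hasSum_norm_adjoint_tensorRight (V x)).tsum_eq, ← tsum_mul_right]
  refine tsum_congr fun j => ?_
  rw [hc, norm_smul, hnorm, mul_pow]

end Tensor

/-! ### Computations along a path -/

section Circuits

variable {Wire : Type*} [DecidableEq Wire] {Q : Wire → Type*} [∀ w, NormedAddCommGroup (Q w)]
  [∀ w, InnerProductSpace ℂ (Q w)] [∀ w, CompleteSpace (Q w)] {Gate : Type*}
  [Fintype Gate] [LinearOrder Gate]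
  {H A : Type*} [NormedAddCommGroup H] [InnerProductSpace ℂ H] [CompleteSpace H]
  [NormedAddCommGroup A] [InnerProductSpace ℂ A] [CompleteSpace A]
  {E : Type*} [NormedAddCommGroup E] [InnerProductSpace ℂ E] [CompleteSpace E]

namespace Circuit

variable (C : Circuit Q Gate) (e : PiTensor Q ≃ₗᵢ[ℂ] HTensor H A) (a : A) (μ : C.Path)

/-- The operator that turns principal inputs into the states after the first `n` stages of the
computation along `μ`. -/
def runOp : ℕ → H →L[ℂ] PiTensor Q
  | 0 => (e.symm.toContinuousLinearEquiv : HTensor H A →L[ℂ] PiTensor Q) ∘L tensorRight H a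
  | n + 1 => C.boutOp μ n ∘L runOp n

variable {C e a μ}

theorem adjoint_symm_equiv :
    adjoint (e.symm.toContinuousLinearEquiv : HTensor H A →L[ℂ] PiTensor Q) =
      (e.toContinuousLinearEquiv : PiTensor Q →L[ℂ] HTensor H A) := by
  simpa using e.symm.adjoint_eq_symm

/-- The domain `E` of `X` is left free: it is `H` for a general density operator and `ℂ` for a pure
state. -/
theorem stateAfter_comp_adjoint (X : E →L[ℂ] H) (n : ℕ) :
    C.stateAfter μ (toWires e (fullInput a (X ∘L adjoint X))) n =
      (C.runOp e a μ n ∘L X) ∘L adjoint (C.runOp e a μ n ∘L X) := by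
  induction n with
  | zero =>
    rw [stateAfter, toWires, fullInput, conj_comp_adjoint, ← adjoint_symm_equiv,
      conj_comp_adjoint]
    rfl
  | succ n ih =>
    rw [stateAfter, ih, conj_comp_adjoint]
    rfl

/-! ### Path probabilities -/

theorem hsNormSq_runOp_zero (ha : ‖a‖ = 1) (X : E →L[ℂ] H) :
    hsNormSq (C.runOp e a μ 0 ∘L X) = hsNormSq X := by
  rw [hsNormSq_comp_of_norm_sq_eq zero_le_one, ENNReal.ofReal_one, one_mul]
  intro x
  have : ‖C.runOp e a μ 0 x‖ = ‖x‖ := (e.symm.norm_map _).trans (norm_tensorRight ha x)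
  rw [this, one_mul]

/-- Telescoping that survives zeros: after the first vanishing `u n` all later terms vanish, and
both sides are `0`. -/
theorem prod_range_div {u : ℕ → ℝ≥0∞} (h0 : u 0 ≠ 0) (htop : ∀ n, u n ≠ ⊤)
    (hz : ∀ n, u n = 0 → u (n + 1) = 0) (n : ℕ) :
    ∏ i ∈ Finset.range n, u (i + 1) / u i = u n / u 0 := by
  induction n with
  | zero => simp [ENNReal.div_self h0 (htop 0)]
  | succ n ih =>
    rw [Finset.prod_range_succ, ih]
    by_cases hn : u n = 0
    · simp [hn, hz n hn]
    · rw [mul_comm, ← mul_div_assoc, ENNReal.div_mul_cancel hn (htop n)]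

theorem pathProb_comp_adjoint (ha : ‖a‖ = 1) {X : E →L[ℂ] H} (h0 : hsNormSq X ≠ 0)
    (htop : hsNormSq X ≠ ⊤) :
    C.pathProb e a μ (X ∘L adjoint X) = hsNormSq (C.runOp e a μ C.depth ∘L X) / hsNormSq X := by
  -- This one bound gives both conditions for telescoping: the norms stay finite, and once zero they
  -- stay zero.
  have hle : ∀ n, hsNormSq (C.runOp e a μ (n + 1) ∘L X) ≤
      ENNReal.ofReal (‖C.boutOp μ n‖ ^ 2) * hsNormSq (C.runOp e a μ n ∘L X) := fun n =>
    hsNormSq_comp_le _ _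
  have key := prod_range_div (u := fun n => hsNormSq (C.runOp e a μ n ∘L X))
    (by rwa [hsNormSq_runOp_zero ha]) (fun n => ?_) (fun n hn => ?_) C.depth
  · rw [hsNormSq_runOp_zero ha] at key
    rw [← key]
    refine Finset.prod_congr rfl fun n _ => ?_
    rw [stageProb, stateAfter_comp_adjoint, stateAfter_comp_adjoint, trace_comp_adjoint,
      trace_comp_adjoint]
  · induction n with
    | zero => rwa [hsNormSq_runOp_zero ha]
    | succ n ih => exact ne_top_of_le_ne_top (ENNReal.mul_ne_top ENNReal.ofReal_ne_top ih) (hle n)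
  · simpa [hn] using hle n

/-! ### Pure inputs and constancy of path probabilities -/

theorem output_rankOne_self (x : H) :
    C.output e a μ (rankOne ℂ x x) =
      rankOne ℂ (e (C.runOp e a μ C.depth x)) (e (C.runOp e a μ C.depth x)) := by
  have h : adjoint (e.toContinuousLinearEquiv : PiTensor Q →L[ℂ] HTensor H A) =
      (e.symm.toContinuousLinearEquiv : HTensor H A →L[ℂ] PiTensor Q) := by
    rw [← adjoint_symm_equiv, adjoint_adjoint]
  rw [output, rankOne_self_eq_comp_adjoint, stateAfter_comp_adjoint, comp_toSpanSingleton,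
    ← rankOne_self_eq_comp_adjoint, ofWires, ← h, comp_rankOne_comp_adjoint]
  rfl

theorem exists_forall_pathProb_eq (ha : ‖a‖ = 1) {U : H →L[ℂ] H}
    (hU : U ∈ unitary (H →L[ℂ] H)) (h : C.ComputesAlong e a μ U) :
    ∃ p : ℝ≥0∞, ∀ ρ, IsDensityOperator ρ → C.pathProb e a μ ρ = p := by
  obtain ⟨c, hc, hV⟩ := norm_sq_eq_of_partialTrace_rankOne
    (V := (e.toContinuousLinearEquiv : PiTensor Q →L[ℂ] HTensor H A) ∘L C.runOp e a μ C.depth)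
    hU fun x hx => by
      have hx0 : x ≠ 0 := by rintro rfl; simp at hx
      -- `ComputesAlong` speaks only of inputs that can follow `μ`; for the pure input `x` this is
      -- ensured by `V x ≠ 0`.
      have hp : C.pathProb e a μ (rankOne ℂ x x) ≠ 0 := by
        have h1 : hsNormSq (toSpanSingleton ℂ x) ≠ ⊤ := by
          rw [hsNormSq_toSpanSingleton]; exact ENNReal.ofReal_ne_top
        rw [rankOne_self_eq_comp_adjoint, pathProb_comp_adjoint ha _ h1]
        · refine (ENNReal.div_pos (fun h0 => hx ?_) h1).ne'
          have := congr($(hsNormSq_eq_zero_iff.1 h0) 1)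
          simp only [comp_apply, toSpanSingleton_apply, one_smul, zero_apply] at this
          rw [comp_apply, this, map_zero]
        · rw [hsNormSq_toSpanSingleton]
          simpa using hx0
      have := h _ (isDensityOperator_rankOne_self hx0) hp
      rwa [output_rankOne_self, comp_rankOne_comp_adjoint] at this
  -- From pure inputs to all: for `ρ = X X†` the probability is `c ‖X‖² / ‖X‖² = c`.
  refine ⟨ENNReal.ofReal c, fun ρ hρ => ?_⟩
  obtain ⟨X, rfl, h0, htop⟩ := hρ.exists_eq_comp_adjoint
  rw [pathProb_comp_adjoint ha h0 htop, hsNormSq_comp_of_norm_sq_eq hc,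
    ENNReal.mul_div_cancel_right h0 htop]
  intro x
  rw [← hV x]
  exact congrArg (· ^ 2) (e.norm_map _).symm

end Circuit

end Circuits

end QCircuit

end

theorem corollary1p2
    {H A : Type*}
    [NormedAddCommGroup H] [InnerProductSpace ℂ H] [CompleteSpace H]
    [TopologicalSpace.SeparableSpace H]
    [NormedAddCommGroup A] [InnerProductSpace ℂ A] [CompleteSpace A]
    [TopologicalSpace.SeparableSpace A]
    (hH : 2 ≤ Module.rank ℂ H)
    {Wire : Type*} [Fintype Wire] [DecidableEq Wire]
    (Q : Wire → Type*) [∀ w, NormedAddCommGroup (Q w)] [∀ w, InnerProductSpace ℂ (Q w)]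
    [∀ w, CompleteSpace (Q w)] [∀ w, TopologicalSpace.SeparableSpace (Q w)]
    {Gate : Type*} [Fintype Gate] [LinearOrder Gate]
    (C : QCircuit.Circuit Q Gate)
    (e : QCircuit.PiTensor Q ≃ₗᵢ[ℂ] QCircuit.HTensor H A)
    (a : A) (ha : ‖a‖ = 1)
    (𝒢 : Set C.Path)
    (h𝒢 : ∀ μ ∈ 𝒢, ∃ U ∈ unitary (H →L[ℂ] H), C.ComputesAlong e a μ U) :
    ∀ ρ ρ' : H →L[ℂ] H, QCircuit.IsDensityOperator ρ → QCircuit.IsDensityOperator ρ' →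
      C.followProb e a 𝒢 ρ = C.followProb e a 𝒢 ρ' := by
  intro ρ ρ' hρ hρ'
  refine tsum_congr fun μ => ?_
  obtain ⟨U, hU, h⟩ := h𝒢 μ μ.2
  obtain ⟨p, hp⟩ := QCircuit.Circuit.exists_forall_pathProb_eq ha hU h
  rw [hp ρ hρ, hp ρ' hρ']
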